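/- **Setting.** Let $N\ge 3$, $d\ge 1$, $T\ge 0$ be integers. A tensor is an $N\times N\times d$ array (real, or more generally complex) with frontal slices $X^{(1)},\dots,X^{(d)}$. Write $\widehat{\mathcal X}$ for its discrete Fourier transform along the third dimension, with slices $\widehat X^{(k)}$; $\mathtt{blkdiag}(\widehat{\mathcal X})$ for the block-diagonal matrix with blocks $\widehat X^{(1)},\dots,\widehat X^{(d)}$; $\mathcal X\star\mathcal Y$ for the t-product (matrix product of slices combined with circular convolution along the third dimension); $\mathcal X^\top$ for the tensor transpose ((conjugate-)transpose every slice and reverse the order of slices $2,\dots,d$); $\mathrm{Tr}(\mathcal X)=\mathrm{Tr}(\mathtt{blkdiag}(\widehat{\mathcal X}))$; and $\langle\mathcal X,\mathcal Y\rangle=\mathrm{Re}\,\mathrm{Tr}(\mathcal X\star\mathcal Y^\top)$. A tensor is positive (semi)definite if all $\widehat X^{(k)}$ are Hermitian positive (semi)definite, and symmetric if $\mathcal X^\top=\mathcal X$, i.e. all $\widehat X^{(k)}$ are Hermitian. For positive definite $\mathcal W$, $\log\mathcal W$ is the tensor with $\mathtt{blkdiag}(\widehat{\log\mathcal W})=\log\mathtt{blkdiag}(\widehat{\mathcal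 W})$. The von Neumann entropy is $\mathcal H(\mathcal W)=\mathrm{Tr}\big(\mathtt{blkdiag}(\widehat{\mathcal W})\log\mathtt{blkdiag}(\widehat{\mathcal W})-\mathtt{blkdiag}(\widehat{\mathcal W})\big)$ (with $0\log 0=0$ for semidefinite $\mathcal W$), and the von Neumann divergence is $\Delta_H(\mathcal W',\mathcal W)=\mathcal H(\mathcal W')-\mathcal H(\mathcal W)-\langle\mathcal W'-\mathcal W,\log\mathcal W\rangle$. **Game.** Let $\beta\in\mathbb R^d$, $\tau\in\mathbb R_{\ge0}^d$, and let $\mathcal S$ be a convex set of positive semidefinite tensors such that $\mathrm{Tr}(\widehat W^{(k)})\le\tau(k)$ and $\widehat W^{(k)}(i,i)\le\beta(k)$ for all $\mathcal W\in\mathcal S$ and all $k,i$. Let $\mathcal L_1,\dots,\mathcal L_T$ be symmetric tensors, with losses $$l_t(\mathcal W)=\mathrm{Tr}(\mathcal W\star\mathcal L_t)=\mathrm{Tr}\big(\mathtt{blkdiag}(\widehat{\mathcal W})\,\mathtt{blkdiag}(\widehat{\mathcal L}_t)\big).$$ Tensor Exponentiated Gradient with learning rate $\eta>0$ plays positive definite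 tensors $\mathcal W_1,\dots,\mathcal W_T\in\mathcal S$ with $\widehat W_1^{(k)}=\frac{\tau(k)}N I$ for all $k$ and $$\mathcal W_{t+1}\in\arg\min_{\mathcal W\in\mathcal S}\ \Delta_H(\mathcal W,\mathcal W_t)+\eta\,\langle\mathcal W,\nabla l_t(\mathcal W_t)\rangle,\qquad \nabla l_t=\mathcal L_t^\top=\mathcal L_t .$$ **Theorem.** Suppose that the spectral norm satisfies $\|\eta\,\mathtt{blkdiag}(\widehat{\mathcal L}_t)\|\le1$ for all $t\le T$. Then the cumulative loss $\sum_{t=1}^T l_t$ is bounded below on $\mathcal S$, and $$\mathrm{Regret}=\sum_{t=1}^T l_t(\mathcal W_t)-\inf_{\mathcal U\in\mathcal S}\sum_{t=1}^T l_t(\mathcal U)\ \le\ \sum_{k=1}^d\Big\{\eta\sum_{t=1}^T\mathrm{Tr}\big(\widehat W_t^{(k)}(\widehat L_t^{(k)})^2\big)+\frac{\tau(k)\log N}{\eta}\Big\}.$$ (For $T=0$, sums over $t$ are empty and the infimum is read as $0$; only the initialization $\widehat W_1^{(k)}=\frac{\tau(k)}N I$ is then required.) -/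

import Mathlib

open scoped Matrix ComplexOrder

noncomputable section

namespace TEG

/-- Third-order `N × N × d` tensors, given by their `d` frontal slices. The slices are indexed
from `0` by `ZMod d`. Entries may be complex; real tensors are the special case of real slices. -/
abbrev CTensor (N d : ℕ) : Type := ZMod d → Matrix (Fin N) (Fin N) ℂ

variable {N d : ℕ} [NeZero d]

/-- Discrete Fourier transform along the third dimension (the `k`-th slice of the result is
`∑ s, exp (-2πi s k / d) • X s`). -/
def fft (X : CTensor N d) : CTensor N d := ZMod.dft X

/-- Inverse discrete Fourier transform along the third dimension. -/
def ifft (Y : CTensor N d) : CTensor N d := ZMod.dft.symm Y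

/-- The t-product: slices are multiplied by circular convolution. -/
def tProd (X Y : CTensor N d) : CTensor N d := fun s => ∑ r, X r * Y (s - r)

/-- Tensor transpose: (conjugate-)transpose every slice and reverse the order of all slices but the
first one. For real tensors the conjugation does nothing. -/
def tTranspose (X : CTensor N d) : CTensor N d := fun s => (X (-s))ᴴ

/-- The block-diagonal matrix whose diagonal blocks are the slices of the Fourier transform. -/
def blkdiag (X : CTensor N d) : Matrix (Fin N × ZMod d) (Fin N × ZMod d) ℂ :=
  Matrix.blockDiagonal (fft X)

/-- The trace of a tensor. -/
def tTrace (X : CTensor N d) : ℂ := (blkdiag X).trace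

/-- The (real) inner product `Tr (X ⋆ Yᵀ)` of two tensors. -/
def tInner (X Y : CTensor N d) : ℝ := (tTrace (tProd X (tTranspose Y))).re

/-- A tensor is symmetric if it equals its tensor transpose. -/
def IsSymm (X : CTensor N d) : Prop := tTranspose X = X

/-- Positive semidefinite tensor: all Fourier slices are (Hermitian) positive semidefinite. -/
def IsPosSemidef (X : CTensor N d) : Prop := ∀ k, (fft X k).PosSemidef

/-- Positive definite tensor: all Fourier slices are (Hermitian) positive definite. -/
def IsPosDef (X : CTensor N d) : Prop := ∀ k, (fft X k).PosDef

/-- Logarithm of a Hermitian matrix, by functional calculus. Zero eigenvalues are sent to `0`, which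
gives the usual convention `0 log 0 = 0` in the entropy. -/
def matLog {n : Type*} [Fintype n] [DecidableEq n] (A : Matrix n n ℂ) : Matrix n n ℂ :=
  cfc Real.log A

/-- Logarithm of a (positive definite) tensor. -/
def tLog (X : CTensor N d) : CTensor N d := ifft (Matrix.blockDiag (matLog (blkdiag X)))

/-- Von Neumann entropy of a tensor. -/
def entropy (W : CTensor N d) : ℝ :=
  (blkdiag W * matLog (blkdiag W) - blkdiag W).trace.re

/-- Von Neumann divergence; the second argument is meant to be positive definite. -/
def divergence (W' W : CTensor N d) : ℝ :=
  entropy W' - entropy W - tInner (W' - W) (tLog W)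

/-- Spectral norm (largest singular value) of a square complex matrix. -/
def specNorm {n : Type*} [Fintype n] [DecidableEq n] (A : Matrix n n ℂ) : ℝ :=
  ‖Matrix.toEuclideanCLM (n := n) (𝕜 := ℂ) A‖

/-- The sets of tensors allowed as decision sets of the block-diagonal linear `(β, τ)` game. -/
structure IsDecisionSet (β τ : ZMod d → ℝ) (S : Set (CTensor N d)) : Prop where
  convex : Convex ℝ S
  posSemidef : ∀ W ∈ S, IsPosSemidef W
  trace_le : ∀ W ∈ S, ∀ k, (fft W k).trace.re ≤ τ k
  diag_le : ∀ W ∈ S, ∀ k i, (fft W k i i).re ≤ β k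

/-- The linear loss `W ↦ Tr (W ⋆ L)`. -/
def loss (L W : CTensor N d) : ℝ := (tTrace (tProd W L)).re

/-- `T` rounds (numbered `0, …, T - 1`) of Tensor Exponentiated Gradient with learning rate `η` on
the set `S`, against the linear losses given by `L`, produce the predictions `W`. The gradient of
`loss (L t)` for the inner product `tInner` is `tTranspose (L t)`, which is `L t` for symmetric
`L t`. -/
structure IsTEGRun (τ : ZMod d → ℝ) (S : Set (CTensor N d)) (η : ℝ) (T : ℕ)
    (L W : ℕ → CTensor N d) : Prop where
  mem : ∀ t < T, W t ∈ S
  posDef : ∀ t < T, IsPosDef (W t)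
  init : ∀ k, fft (W 0) k = ((τ k / N : ℝ) : ℂ) • (1 : Matrix (Fin N) (Fin N) ℂ)
  update : ∀ t, t + 1 < T →
    IsMinOn (fun U => divergence U (W t) + η * tInner U (tTranspose (L t))) S (W (t + 1))

/-- Cumulative loss over `T` rounds of the best fixed tensor of `S` in hindsight. -/
def bestLoss (S : Set (CTensor N d)) (T : ℕ) (L : ℕ → CTensor N d) : ℝ :=
  sInf ((fun U => ∑ t ∈ Finset.range T, loss (L t) U) '' S)

/-- The regret of the predictions `W` over `T` rounds. -/
def regret (S : Set (CTensor N d)) (T : ℕ) (L W : ℕ → CTensor N d) : ℝ :=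
  ∑ t ∈ Finset.range T, loss (L t) (W t) - bestLoss S T L

theorem fft_tProd (X Y : CTensor N d) (k : ZMod d) : fft (tProd X Y) k = fft X k * fft Y k := by
  simp only [fft, ZMod.dft_apply, tProd, Finset.smul_sum, Finset.sum_mul, Finset.mul_sum]
  rw [Finset.sum_comm]
  conv_rhs => rw [Finset.sum_comm]
  refine Finset.sum_congr rfl fun r _ => ?_
  refine Fintype.sum_equiv (Equiv.subRight r) _ _ fun s => ?_
  rw [Equiv.subRight_apply, Matrix.smul_mul, Matrix.mul_smul, smul_smul, ← AddChar.map_add_eq_mul]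
  congr 2
  ring

/-- The loss in the Fourier domain. -/
theorem loss_eq (L W : CTensor N d) : loss L W = (blkdiag W * blkdiag L).trace.re := by
  have h : fft (tProd W L) = fun k => fft W k * fft L k := funext (fft_tProd W L)
  rw [loss, tTrace, blkdiag, blkdiag, blkdiag, h, Matrix.blockDiagonal_mul]

/-- The Fourier slices of the tensor transpose are the Hermitian transposes. -/
theorem fft_tTranspose (X : CTensor N d) (k : ZMod d) : fft (tTranspose X) k = (fft X k)ᴴ := by
  simp only [fft, ZMod.dft_apply, tTranspose, Matrix.conjTranspose_sum, Matrix.conjTranspose_smul]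
  refine Fintype.sum_equiv (Equiv.neg _) _ _ fun s => ?_
  rw [Equiv.neg_apply, ← starRingEnd_apply, ← AddChar.map_neg_eq_conj]
  congr 2
  ring

/-- The inner product in the Fourier domain. -/
theorem tInner_eq (X Y : CTensor N d) : tInner X Y = (blkdiag X * (blkdiag Y)ᴴ).trace.re := by
  have h : fft (tTranspose Y) = fun k => (fft Y k)ᴴ := funext (fft_tTranspose Y)
  rw [tInner, ← loss, loss_eq, blkdiag, blkdiag, blkdiag, h, Matrix.blockDiagonal_conjTranspose]

end TEG

end

noncomputable section

namespace TEG

/-! ### Scalar inequalities -/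

/-! This is the mirror-descent argument for the von Neumann divergence `Δ`, carried out on
block-diagonal matrices. Let `V` minimize `Δ(·, W) + η⟨·, L⟩` on `S`. First-order optimality gives
the Pythagorean inequality `Δ(V, W) + η⟨V - U, L⟩ + Δ(U, V) ≤ Δ(U, W)` (`vnDiv_pythagoras`). The
remaining part `η⟨W - V, L⟩` of the one-step regret is at most `Δ(V, W) + η² Tr(W L²)`, by
`vnDiv_ge_of_contraction` with `K = -ηL`. Adding the two cancels `Δ(V, W)`, the sum over rounds
telescopes, and `vnDiv_init_le` bounds `Δ(U, W₁)` by `∑ τ(k) log N`.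

The local bound needs no Golden-Thompson inequality. If `A`, `B` have eigenvalues `aᵢ`, `bⱼ` and
eigenvectors `uᵢ`, `vⱼ`, then `Δ(A, B)` is the sum of the scalar divergences of `aᵢ` and `bⱼ` with
weights `|⟨uᵢ, vⱼ⟩|²` (`vnDiv_eq_sum`). Scalar inequalities applied term by term therefore become
trace inequalities. -/

theorem log_ge_rational {x : ℝ} (hx : 0 < x) :
    (x - 1) * (5 * x + 1) / (2 * x * (x + 2)) ≤ Real.log x := by
  set h : ℝ → ℝ := fun y => Real.log y - (y - 1) * (5 * y + 1) / (2 * y * (y + 2)) with hh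
  -- The rational function matches `log` to third order at `1`, so the derivative of the difference
  -- changes sign only there and `1` is the global minimum.
  have hd : ∀ y : ℝ, 0 < y → HasDerivAt h ((y - 1) ^ 3 / (y ^ 2 * (y + 2) ^ 2)) y := by
    intro y hy
    have h1 := (((hasDerivAt_id y).sub_const 1).mul
      (((hasDerivAt_id y).const_mul 5).add_const 1)).div
      (((hasDerivAt_id y).const_mul 2).mul ((hasDerivAt_id y).add_const 2))
      (by simp only [id, Pi.mul_apply]; positivity)
    refine ((Real.hasDerivAt_log hy.ne').sub h1).congr_deriv ?_
    simp only [id, Pi.mul_apply]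
    field_simp
    ring
  suffices h 1 ≤ h x by
    simp only [hh, Real.log_one, sub_self, zero_mul, zero_div] at this
    linarith
  rcases le_total x 1 with h1 | h1
  · have hanti : AntitoneOn h (Set.Icc x 1) := by
      refine antitoneOn_of_deriv_nonpos (convex_Icc _ _)
        (fun y hy => (hd y (hx.trans_le hy.1)).continuousAt.continuousWithinAt)
        (fun y hy => ?_) (fun y hy => ?_)
      all_goals
        rw [interior_Icc] at hy
        have hy0 : 0 < y := hx.trans hy.1
      · exact (hd y hy0).differentiableAt.differentiableWithinAt
      · rw [(hd y hy0).deriv]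
        refine div_nonpos_of_nonpos_of_nonneg ?_ (by positivity)
        exact Odd.pow_nonpos (by decide) (by linarith [hy.2])
    exact hanti ⟨le_rfl, h1⟩ ⟨h1, le_rfl⟩ h1
  · have hmono : MonotoneOn h (Set.Icc 1 x) := by
      refine monotoneOn_of_deriv_nonneg (convex_Icc _ _)
        (fun y hy => (hd y (one_pos.trans_le hy.1)).continuousAt.continuousWithinAt)
        (fun y hy => ?_) (fun y hy => ?_)
      all_goals
        rw [interior_Icc] at hy
        have hy0 : 0 < y := one_pos.trans hy.1
      · exact (hd y hy0).differentiableAt.differentiableWithinAt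
      · rw [(hd y hy0).deriv]
        have : 0 ≤ y - 1 := by linarith [hy.1]
        positivity
    exact hmono ⟨le_rfl, h1⟩ ⟨h1, le_rfl⟩ h1

/-- Scalar relative entropy. -/
def scalarDiv (u w : ℝ) : ℝ := u * Real.log u - u * Real.log w - u + w

/-- This is `log_ge_rational` at `u / w`, multiplied by `u`. The denominator is linear in `u` and
`w`, so that the dual quadratic form has weights that sum to traces against `A` and `B`. -/
theorem scalarDiv_ge {u w : ℝ} (hu : 0 ≤ u) (hw : 0 < w) :
    3 * (u - w) ^ 2 / (2 * (2 * w + u)) ≤ scalarDiv u w := by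
  rcases hu.eq_or_lt with rfl | hu
  · simp only [scalarDiv, zero_mul]
    rw [div_le_iff₀ (by positivity)]
    nlinarith [sq_nonneg w]
  · have h := log_ge_rational (div_pos hu hw)
    rw [Real.log_div hu.ne' hw.ne'] at h
    have h2 := mul_le_mul_of_nonneg_left h hu.le
    have h3 : 3 * (u - w) ^ 2 / (2 * (2 * w + u)) =
        u * ((u / w - 1) * (5 * (u / w) + 1) / (2 * (u / w) * (u / w + 2))) - u + w := by
      have : u + 2 * w ≠ 0 := by positivity
      have : 2 * w + u ≠ 0 := by positivity
      field_simp
      ring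
    rw [scalarDiv, h3]
    linarith

theorem scalarDiv_le {u w : ℝ} (hu : 0 ≤ u) (hw : 0 < w) :
    scalarDiv u w ≤ (u - w) ^ 2 / w := by
  rcases hu.eq_or_lt with rfl | hu
  · simp only [scalarDiv, zero_mul]
    rw [le_div_iff₀ hw]
    nlinarith
  · have h := Real.log_le_sub_one_of_pos (div_pos hu hw)
    rw [Real.log_div hu.ne' hw.ne'] at h
    have h2 := mul_le_mul_of_nonneg_left h hu.le
    have h3 : (u - w) ^ 2 / w = u * (u / w - 1) - u + w := by
      field_simp
      ring
    rw [scalarDiv, h3]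
    linarith

/-- The variational form of `scalarDiv_ge`, with complex weights. -/
theorem scalarDiv_mul_normSq_ge {u w : ℝ} (hu : 0 ≤ u) (hw : 0 < w) (a z : ℂ) :
    (u - w) * (a * star z).re - (w / 3 + u / 6) * Complex.normSq z
      ≤ scalarDiv u w * Complex.normSq a := by
  have h := mul_le_mul_of_nonneg_right (scalarDiv_ge hu hw) (Complex.normSq_nonneg a)
  refine le_trans ?_ h
  have hpos : 0 < 2 * (2 * w + u) := by positivity
  rw [div_mul_eq_mul_div, le_div_iff₀ hpos]
  simp only [Complex.normSq_apply, Complex.mul_re, Complex.star_def, Complex.conj_re,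
    Complex.conj_im]
  -- The left side is concave in `z`, with maximizer `z = 3(u - w)a / (2w + u)`; both squares vanish
  -- there.
  nlinarith [sq_nonneg (3 * (u - w) * a.re - (2 * w + u) * z.re),
    sq_nonneg (3 * (u - w) * a.im - (2 * w + u) * z.im)]

/-! ### Traces in eigenbases -/

section Matrices

variable {n : Type*} [Fintype n] [DecidableEq n]

theorem cfc_eq_conj {A : Matrix n n ℂ} (hA : A.IsHermitian) (f : ℝ → ℝ) :
    cfc f A = (hA.eigenvectorUnitary : Matrix n n ℂ) *
      Matrix.diagonal (fun i => (f (hA.eigenvalues i) : ℂ)) *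
      (hA.eigenvectorUnitary : Matrix n n ℂ)ᴴ := by
  rw [hA.cfc_eq, Matrix.IsHermitian.cfc, Unitary.conjStarAlgAut_apply]
  rfl

/-- The matrix `Y` expressed in the eigenbases of `A` and `B`. -/
def eigCoord {A B : Matrix n n ℂ} (hA : A.IsHermitian) (hB : B.IsHermitian) (Y : Matrix n n ℂ) :
    Matrix n n ℂ :=
  (hA.eigenvectorUnitary : Matrix n n ℂ)ᴴ * Y * (hB.eigenvectorUnitary : Matrix n n ℂ)

/-- Diagonalize `A` and `B` and move one unitary around the trace. Taking `f`, `g` to be the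
identity or the constant `1` expresses all the traces below over the same double index. -/
theorem trace_cfc_mul_mul_cfc_mul {A B : Matrix n n ℂ} (hA : A.IsHermitian) (hB : B.IsHermitian)
    (f g : ℝ → ℝ) (Y Z : Matrix n n ℂ) :
    (cfc f A * Y * cfc g B * Zᴴ).trace.re = ∑ i, ∑ j, f (hA.eigenvalues i) * g (hB.eigenvalues j) *
      (eigCoord hA hB Y i j * star (eigCoord hA hB Z i j)).re := by
  have h : (cfc f A * Y * cfc g B * Zᴴ).trace =
      (Matrix.diagonal (fun i => (f (hA.eigenvalues i) : ℂ)) * eigCoord hA hB Y *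
        Matrix.diagonal (fun i => (g (hB.eigenvalues i) : ℂ)) * (eigCoord hA hB Z)ᴴ).trace := by
    rw [cfc_eq_conj hA, cfc_eq_conj hB, eigCoord, eigCoord]
    simp only [Matrix.conjTranspose_mul, Matrix.conjTranspose_conjTranspose, Matrix.mul_assoc]
    rw [Matrix.trace_mul_comm]
    simp only [Matrix.mul_assoc]
  rw [h, Matrix.trace, Complex.re_sum]
  refine Finset.sum_congr rfl fun i _ => ?_
  rw [Matrix.diag_apply, Matrix.mul_apply, Complex.re_sum]
  refine Finset.sum_congr rfl fun j _ => ?_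
  rw [Matrix.mul_diagonal, Matrix.diagonal_mul, Matrix.conjTranspose_apply]
  simp only [Complex.mul_re, Complex.mul_im, Complex.ofReal_re, Complex.ofReal_im]
  ring

/-- Von Neumann divergence of Hermitian matrices. -/
def vnDiv (A B : Matrix n n ℂ) : ℝ :=
  (A * matLog A - A).trace.re - (B * matLog B - B).trace.re - ((A - B) * matLog B).trace.re

theorem mul_matLog {A : Matrix n n ℂ} (hA : A.IsHermitian) :
    A * matLog A = cfc (fun x => x * Real.log x) A := by
  have h : IsSelfAdjoint A := hA
  -- Every function is continuous on a finite spectrum, so the singularity of `log` at `0` is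
  -- harmless.
  have hf : (spectrum ℝ A).Finite := Matrix.finite_real_spectrum
  rw [cfc_mul (fun x => x) Real.log A (by fun_prop) (hf.continuousOn _), cfc_id' ℝ A, matLog]

theorem normSq_eigCoord {A B : Matrix n n ℂ} (hA : A.IsHermitian) (hB : B.IsHermitian)
    (Z : Matrix n n ℂ) (i j : n) :
    (eigCoord hA hB Z i j * star (eigCoord hA hB Z i j)).re =
      Complex.normSq (eigCoord hA hB Z i j) := by
  rw [Complex.star_def, Complex.mul_conj, Complex.ofReal_re]

theorem trace_cfc_mul_cfc {A B : Matrix n n ℂ} (hA : A.IsHermitian) (hB : B.IsHermitian)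
    (f g : ℝ → ℝ) :
    (cfc f A * cfc g B).trace.re = ∑ i, ∑ j, f (hA.eigenvalues i) * g (hB.eigenvalues j) *
      Complex.normSq (eigCoord hA hB 1 i j) := by
  have h := trace_cfc_mul_mul_cfc_mul hA hB f g 1 1
  simpa only [normSq_eigCoord, Matrix.mul_one, Matrix.conjTranspose_one] using h

theorem vnDiv_eq_sum {A B : Matrix n n ℂ} (hA : A.IsHermitian) (hB : B.IsHermitian) :
    vnDiv A B = ∑ i, ∑ j, scalarDiv (hA.eigenvalues i) (hB.eigenvalues j) *
      Complex.normSq (eigCoord hA hB 1 i j) := by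
  have hA' : IsSelfAdjoint A := hA
  have hB' : IsSelfAdjoint B := hB
  have h1 := trace_cfc_mul_cfc hA hB (fun x => x * Real.log x) (fun _ => 1)
  have h2 := trace_cfc_mul_cfc hA hB (fun x => x) Real.log
  have h3 := trace_cfc_mul_cfc hA hB (fun x => x) (fun _ => 1)
  have h4 := trace_cfc_mul_cfc hA hB (fun _ => 1) (fun x => x)
  simp only [cfc_id' ℝ A, cfc_id' ℝ B, cfc_const_one ℝ A, cfc_const_one ℝ B, mul_one, one_mul,
    ← mul_matLog hA] at h1 h2 h3 h4
  have h5 : vnDiv A B = (A * matLog A).trace.re - (A * cfc Real.log B).trace.re - A.trace.re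
      + B.trace.re := by
    simp only [vnDiv, Matrix.sub_mul, Matrix.trace_sub, Complex.sub_re, matLog]
    ring
  rw [h5, h1, h2, h3, h4]
  simp only [← Finset.sum_sub_distrib, ← Finset.sum_add_distrib]
  refine Finset.sum_congr rfl fun i _ => Finset.sum_congr rfl fun j _ => ?_
  rw [scalarDiv]
  ring

/-- Variational lower bound for the von Neumann divergence. -/
theorem vnDiv_ge {A B X : Matrix n n ℂ} (hA : A.PosSemidef) (hB : B.PosDef) (hX : X.IsHermitian) :
    ((A - B) * X).trace.re - (B * X ^ 2).trace.re / 3 - (A * X ^ 2).trace.re / 6 ≤ vnDiv A B := by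
  have hA' : IsSelfAdjoint A := hA.1
  have hB' : IsSelfAdjoint B := hB.1
  have h1 := trace_cfc_mul_mul_cfc_mul hA.1 hB.1 (fun x => x) (fun _ => 1) 1 X
  have h2 := trace_cfc_mul_mul_cfc_mul hA.1 hB.1 (fun _ => 1) (fun x => x) 1 X
  have h3 := trace_cfc_mul_mul_cfc_mul hA.1 hB.1 (fun x => x) (fun _ => 1) X X
  have h4 := trace_cfc_mul_mul_cfc_mul hA.1 hB.1 (fun _ => 1) (fun x => x) X X
  simp only [cfc_id' ℝ A, cfc_id' ℝ B, cfc_const_one ℝ A, cfc_const_one ℝ B, mul_one, one_mul,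
    normSq_eigCoord, hX.eq] at h1 h2 h3 h4
  have h5 : (A * X ^ 2).trace = (A * X * X).trace := by rw [pow_two, Matrix.mul_assoc]
  have h6 : (B * X ^ 2).trace = (X * B * X).trace := by
    rw [pow_two, ← Matrix.mul_assoc, Matrix.trace_mul_comm, Matrix.mul_assoc]
  rw [vnDiv_eq_sum hA.1 hB.1, h5, h6, Matrix.sub_mul, Matrix.trace_sub, Complex.sub_re, h1, h2, h3,
    h4]
  simp only [Finset.sum_div, ← Finset.sum_sub_distrib]
  refine Finset.sum_le_sum fun i _ => Finset.sum_le_sum fun j _ => ?_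
  refine le_trans (le_of_eq ?_) (scalarDiv_mul_normSq_ge (hA.eigenvalues_nonneg i)
    (hB.eigenvalues_pos j) (eigCoord hA.1 hB.1 1 i j) (eigCoord hA.1 hB.1 X i j))
  ring

/-- Near a positive definite matrix the von Neumann divergence is at most quadratic. -/
theorem exists_vnDiv_le {B : Matrix n n ℂ} (hB : B.PosDef) :
    ∃ C : ℝ, ∀ A : Matrix n n ℂ, A.PosSemidef →
      vnDiv A B ≤ C * ((A - B) * (A - B)).trace.re := by
  refine ⟨∑ j, (hB.1.eigenvalues j)⁻¹, fun A hA => ?_⟩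
  have hA' : IsSelfAdjoint A := hA.1
  have hB' : IsSelfAdjoint B := hB.1
  have h1 := trace_cfc_mul_cfc hA.1 hB.1 (fun x => x * x) (fun _ => 1)
  have h2 := trace_cfc_mul_cfc hA.1 hB.1 (fun x => x) (fun x => x)
  have h3 := trace_cfc_mul_cfc hA.1 hB.1 (fun _ => 1) (fun x => x * x)
  have hfA : cfc (fun x : ℝ => x * x) A = A * A := by
    rw [cfc_mul (fun x : ℝ => x) (fun x => x) A, cfc_id' ℝ A]
  have hfB : cfc (fun x : ℝ => x * x) B = B * B := by
    rw [cfc_mul (fun x : ℝ => x) (fun x => x) B, cfc_id' ℝ B]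
  simp only [cfc_id' ℝ A, cfc_id' ℝ B, cfc_const_one ℝ A, cfc_const_one ℝ B, mul_one, one_mul,
    hfA, hfB] at h1 h2 h3
  have h4 : ((A - B) * (A - B)).trace.re =
      (A * A).trace.re - 2 * (A * B).trace.re + (B * B).trace.re := by
    simp only [Matrix.sub_mul, Matrix.mul_sub, Matrix.trace_sub, Complex.sub_re]
    rw [Matrix.trace_mul_comm B A]
    ring
  rw [h4, vnDiv_eq_sum hA.1 hB.1, h1, h2, h3]
  simp only [Finset.mul_sum, ← Finset.sum_sub_distrib, ← Finset.sum_add_distrib]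
  refine Finset.sum_le_sum fun i _ => Finset.sum_le_sum fun j _ => ?_
  have h5 : (hB.1.eigenvalues j)⁻¹ ≤ ∑ j, (hB.1.eigenvalues j)⁻¹ :=
    Finset.single_le_sum (f := fun j => (hB.1.eigenvalues j)⁻¹)
      (fun j _ => inv_nonneg.2 (hB.eigenvalues_pos j).le) (Finset.mem_univ j)
  calc _ ≤ (hA.1.eigenvalues i - hB.1.eigenvalues j) ^ 2 / hB.1.eigenvalues j *
        Complex.normSq (eigCoord hA.1 hB.1 1 i j) :=
        mul_le_mul_of_nonneg_right (scalarDiv_le (hA.eigenvalues_nonneg i) (hB.eigenvalues_pos j))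
          (Complex.normSq_nonneg _)
    _ = (hB.1.eigenvalues j)⁻¹ * ((hA.1.eigenvalues i - hB.1.eigenvalues j) ^ 2 *
        Complex.normSq (eigCoord hA.1 hB.1 1 i j)) := by ring
    _ ≤ (∑ j, (hB.1.eigenvalues j)⁻¹) * ((hA.1.eigenvalues i - hB.1.eigenvalues j) ^ 2 *
        Complex.normSq (eigCoord hA.1 hB.1 1 i j)) :=
        mul_le_mul_of_nonneg_right h5 (mul_nonneg (sq_nonneg _) (Complex.normSq_nonneg _))
    _ = _ := by ring

/-! ### Local lower bound for contractions -/

theorem trace_mul_nonneg {A B : Matrix n n ℂ} (hA : A.PosSemidef) (hB : B.PosSemidef) :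
    0 ≤ (A * B).trace.re := by
  have hA' : IsSelfAdjoint A := hA.1
  have hB' : IsSelfAdjoint B := hB.1
  have h := trace_cfc_mul_cfc hA.1 hB.1 (fun x => x) (fun x => x)
  simp only [cfc_id' ℝ A, cfc_id' ℝ B] at h
  rw [h]
  exact Finset.sum_nonneg fun i _ => Finset.sum_nonneg fun j _ =>
    mul_nonneg (mul_nonneg (hA.eigenvalues_nonneg i) (hB.eigenvalues_nonneg j))
      (Complex.normSq_nonneg _)

theorem vnDiv_ge_of_contraction {A B K : Matrix n n ℂ} (hA : A.PosSemidef) (hB : B.PosDef)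
    (hK : K.IsHermitian) (hK2 : (1 - K ^ 2).PosSemidef) :
    ((A - B) * K).trace.re - (B * K ^ 2).trace.re ≤ vnDiv A B := by
  have hsq {M : Matrix n n ℂ} (hM : M.IsHermitian) : (M ^ 2).PosSemidef := by
    have h := Matrix.posSemidef_conjTranspose_mul_self M
    rwa [hM.eq, ← pow_two] at h
  have hK1 : (1 - K).PosSemidef := by
    -- `K² ≤ 1` yields `K ≤ 1` without spectral theory: `2(1 - K) = (1 - K)² + (1 - K²)`.
    have h : (1 - K) = (1 / 2 : ℝ) • ((1 - K) ^ 2 + (1 - K ^ 2)) := by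
      have : (1 - K) ^ 2 + (1 - K ^ 2) = (2 : ℝ) • (1 - K) := by
        rw [two_smul]
        noncomm_ring
      rw [this, smul_smul]
      norm_num
    rw [h]
    exact ((hsq (Matrix.isHermitian_one.sub hK)).add hK2).smul (by norm_num)
  have hc {P : Matrix n n ℂ} (hP : P.PosSemidef) : (K * P * K).PosSemidef := by
    have h := hP.conjTranspose_mul_mul_same K
    rwa [hK.eq] at h
  have e1 : K * (1 - K) * K = K ^ 2 - K ^ 3 := by noncomm_ring
  have e2 : K * (1 - K ^ 2) * K = K ^ 2 - K ^ 4 := by noncomm_ring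
  have key {P : Matrix n n ℂ} (hP : P.PosSemidef) : 0 ≤ (P * K ^ 2).trace.re ∧
      (P * K ^ 3).trace.re ≤ (P * K ^ 2).trace.re ∧
      (P * K ^ 4).trace.re ≤ (P * K ^ 2).trace.re := by
    have h1 := trace_mul_nonneg hP (hc hK1)
    have h2 := trace_mul_nonneg hP (hc hK2)
    rw [e1, Matrix.mul_sub, Matrix.trace_sub, Complex.sub_re] at h1
    rw [e2, Matrix.mul_sub, Matrix.trace_sub, Complex.sub_re] at h2
    exact ⟨trace_mul_nonneg hP (hsq hK), by linarith, by linarith⟩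
  -- With `X = K + cK²`, the bounds in `key` give `Tr(P X²) ≤ (1 + c)² Tr(P K²)`. The `A`-terms then
  -- cancel favourably if `(1 + c)²/6 ≤ c`, and the `B`-terms cost at most `Tr(B K²)` if `c + (1 +
  -- c)²/3 ≤ 1`; `c = 3/10` meets both.
  have hX : (K + (3 / 10 : ℝ) • K ^ 2).IsHermitian :=
    hK.add ((hsq hK).1.smul (IsSelfAdjoint.all _))
  have hX2 : (K + (3 / 10 : ℝ) • K ^ 2) ^ 2 = K ^ 2 + (3 / 5 : ℝ) • K ^ 3 + (9 / 100 : ℝ) • K ^ 4 := by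
    simp only [pow_succ, pow_zero, one_mul, Matrix.add_mul, Matrix.mul_add, Matrix.smul_mul,
      Matrix.mul_smul, Matrix.mul_assoc]
    module
  have h := vnDiv_ge hA hB hX
  rw [hX2] at h
  simp only [Matrix.mul_add, Matrix.sub_mul, Matrix.mul_smul, Matrix.trace_add, Matrix.trace_sub,
    Matrix.trace_smul, Complex.add_re, Complex.sub_re, Complex.smul_re, smul_eq_mul] at h ⊢
  obtain ⟨a1, a2, a3⟩ := key hA
  obtain ⟨b1, b2, b3⟩ := key hB.posSemidef
  linarith

theorem posSemidef_one_sub_sq_of_specNorm_le {K : Matrix n n ℂ} (hK : K.IsHermitian)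
    (h : specNorm K ≤ 1) : (1 - K ^ 2).PosSemidef := by
  refine Matrix.PosSemidef.of_dotProduct_mulVec_nonneg
    (Matrix.isHermitian_one.sub (hK.pow 2)) fun x => ?_
  have h1 : star x ⬝ᵥ ((1 - K ^ 2) *ᵥ x) =
      star x ⬝ᵥ x - star (K *ᵥ x) ⬝ᵥ (K *ᵥ x) := by
    rw [Matrix.sub_mulVec, Matrix.one_mulVec, dotProduct_sub, pow_two, Matrix.star_mulVec, hK.eq,
      ← Matrix.mulVec_mulVec, Matrix.dotProduct_mulVec (star x) K]
  have h2 (y : n → ℂ) : star y ⬝ᵥ y = ((‖WithLp.toLp 2 y‖ ^ 2 : ℝ) : ℂ) := by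
    rw [EuclideanSpace.norm_sq_eq, dotProduct, Complex.ofReal_sum]
    refine Finset.sum_congr rfl fun i _ => ?_
    rw [Pi.star_apply, Complex.star_def, Complex.conj_mul', Complex.ofReal_pow]
  have h3 : ‖WithLp.toLp 2 (K *ᵥ x)‖ ≤ ‖WithLp.toLp 2 x‖ := by
    have := (Matrix.toEuclideanCLM (n := n) (𝕜 := ℂ) K).le_of_opNorm_le h (WithLp.toLp 2 x)
    rwa [Matrix.toEuclideanCLM_toLp, one_mul] at this
  rw [h1, h2, h2, ← Complex.ofReal_sub, Complex.zero_le_real, sub_nonneg]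
  gcongr

/-! ### Three-point identity and Pythagorean inequality -/

theorem vnDiv_three_point (Y V W : Matrix n n ℂ) :
    vnDiv Y W = vnDiv Y V + vnDiv V W + ((Y - V) * (matLog V - matLog W)).trace.re := by
  simp only [vnDiv, Matrix.mul_sub, Matrix.sub_mul, Matrix.trace_sub, Complex.sub_re]
  ring

/-- Generalized Pythagorean inequality for a minimizer of the regularized linear loss. -/
theorem vnDiv_pythagoras {U V W G : Matrix n n ℂ} (hV : V.PosDef)
    (hU : ∀ r : ℝ, 0 < r → r ≤ 1 → (V + r • (U - V)).PosSemidef)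
    (hmin : ∀ r : ℝ, 0 < r → r ≤ 1 →
      vnDiv V W + (V * G).trace.re ≤
        vnDiv (V + r • (U - V)) W + ((V + r • (U - V)) * G).trace.re) :
    vnDiv V W + ((V - U) * G).trace.re + vnDiv U V ≤ vnDiv U W := by
  obtain ⟨C, hC⟩ := exists_vnDiv_le hV
  set q := ((U - V) * (U - V)).trace.re with hq
  set g := ((U - V) * (matLog V - matLog W)).trace.re + ((U - V) * G).trace.re with hg
  -- Along the segment the objective changes by `r g + Δ(V + r(U - V), V)`, and the last term is
  -- `O(r²)`. This replaces differentiating the entropy.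
  have key : ∀ r : ℝ, 0 < r → r ≤ 1 → 0 ≤ C * q * r + g := by
    intro r hr hr1
    have h1 := hmin r hr hr1
    have h2 := hC _ (hU r hr hr1)
    rw [vnDiv_three_point (V + r • (U - V)) V W] at h1
    simp only [add_sub_cancel_left, Matrix.add_mul, Matrix.smul_mul, Matrix.mul_smul,
      Matrix.trace_add, Matrix.trace_smul, Complex.add_re, Complex.smul_re, smul_eq_mul,
      ← hq] at h1 h2
    have h3 : 0 ≤ r * (C * q * r + g) := by
      rw [hg]
      linarith
    exact nonneg_of_mul_nonneg_right h3 hr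
  have hg0 : 0 ≤ g := by
    by_contra! hneg
    have hpos : 0 < |C * q| - g := by linarith [abs_nonneg (C * q)]
    -- This `r` solves `|Cq| r + g = r g`, whose right side is negative, contradicting `key`.
    have hr : 0 < -g / (|C * q| - g) := div_pos (by linarith) hpos
    have h := key _ hr ((div_le_one hpos).2 (by linarith [abs_nonneg (C * q)]))
    have h2 : -g / (|C * q| - g) * (|C * q| - g) = -g := div_mul_cancel₀ _ hpos.ne'
    set r := -g / (|C * q| - g)
    have h3 : C * q * r ≤ |C * q| * r := mul_le_mul_of_nonneg_right (le_abs_self _) hr.le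
    have h4 := mul_neg_of_pos_of_neg hr hneg
    linarith
  have h := vnDiv_three_point U V W
  have h1 : ((V - U) * G).trace.re = -((U - V) * G).trace.re := by
    rw [← neg_sub U V, Matrix.neg_mul, Matrix.trace_neg, Complex.neg_re]
  rw [h, h1]
  linarith

/-! ### Block-diagonal matrices -/

theorem aeval_blockDiagonal {o : Type*} [Fintype o] [DecidableEq o] (p : Polynomial ℝ)
    (M : o → Matrix n n ℂ) :
    Polynomial.aeval (Matrix.blockDiagonal M) p =
      Matrix.blockDiagonal fun k => Polynomial.aeval (M k) p := by
  induction p using Polynomial.induction_on' with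
  | add p q hp hq =>
    simp only [map_add, hp, hq]
    exact (Matrix.blockDiagonal_add _ _).symm
  | monomial m a =>
    simp only [Polynomial.aeval_monomial, ← Algebra.smul_def]
    rw [← Matrix.blockDiagonal_pow, ← Matrix.blockDiagonal_smul]
    rfl

/-- One Lagrange interpolant agrees with `f` on all the finite spectra involved, and polynomials act
blockwise. -/
theorem cfc_blockDiagonal {o : Type*} [Fintype o] [DecidableEq o] {M : o → Matrix n n ℂ}
    (hM : ∀ k, (M k).IsHermitian) (f : ℝ → ℝ) :
    cfc f (Matrix.blockDiagonal M) = Matrix.blockDiagonal fun k => cfc f (M k) := by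
  have hB : (Matrix.blockDiagonal M).IsHermitian := by
    rw [Matrix.IsHermitian, Matrix.blockDiagonal_conjTranspose]
    exact congrArg _ (funext fun k => (hM k).eq)
  have hfin : (spectrum ℝ (Matrix.blockDiagonal M) ∪ ⋃ k, spectrum ℝ (M k)).Finite :=
    Matrix.finite_real_spectrum.union (Set.finite_iUnion fun k => Matrix.finite_real_spectrum)
  set p := Lagrange.interpolate hfin.toFinset id f with hp
  have hev : ∀ x ∈ spectrum ℝ (Matrix.blockDiagonal M) ∪ ⋃ k, spectrum ℝ (M k),
      f x = p.eval x := fun x hx =>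
    (Lagrange.eval_interpolate_at_node f Function.injective_id.injOn
      (hfin.mem_toFinset.2 hx)).symm
  have h1 : cfc f (Matrix.blockDiagonal M) = Polynomial.aeval (Matrix.blockDiagonal M) p := by
    rw [cfc_congr (g := p.eval) fun x hx => hev x (Or.inl hx)]
    exact cfc_polynomial p _ hB
  have h2 (k : o) : cfc f (M k) = Polynomial.aeval (M k) p := by
    rw [cfc_congr (g := p.eval) fun x hx => hev x (Or.inr (Set.mem_iUnion.2 ⟨k, hx⟩))]
    exact cfc_polynomial p _ (hM k)
  rw [h1, aeval_blockDiagonal]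
  exact congrArg _ (funext fun k => (h2 k).symm)

theorem vnDiv_blockDiagonal {o : Type*} [Fintype o] [DecidableEq o] {X Y : o → Matrix n n ℂ}
    (hX : ∀ k, (X k).IsHermitian) (hY : ∀ k, (Y k).IsHermitian) :
    vnDiv (Matrix.blockDiagonal X) (Matrix.blockDiagonal Y) = ∑ k, vnDiv (X k) (Y k) := by
  simp only [vnDiv, matLog]
  rw [cfc_blockDiagonal hX, cfc_blockDiagonal hY, ← Matrix.blockDiagonal_sub,
    ← Matrix.blockDiagonal_mul, ← Matrix.blockDiagonal_mul, ← Matrix.blockDiagonal_mul,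
    ← Matrix.blockDiagonal_sub, ← Matrix.blockDiagonal_sub]
  simp only [Matrix.trace_blockDiagonal, Complex.re_sum, Finset.sum_sub_distrib, Pi.sub_apply]

/-! ### Divergence from a multiple of the identity -/

/-- Each eigenvalue of a positive semidefinite matrix is at most its trace, and `log` is monotone.
-/
theorem trace_mul_matLog_le {A : Matrix n n ℂ} (hA : A.PosSemidef) :
    (A * matLog A).trace.re ≤ A.trace.re * Real.log A.trace.re := by
  have h1 : (A * matLog A).trace.re =
      ∑ i, hA.1.eigenvalues i * Real.log (hA.1.eigenvalues i) := by
    rw [mul_matLog hA.1, cfc_eq_conj hA.1, Matrix.trace_mul_comm, ← Matrix.mul_assoc,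
      ← Matrix.star_eq_conjTranspose, Unitary.coe_star_mul_self, Matrix.one_mul,
      Matrix.trace_diagonal, Complex.re_sum]
    simp only [Complex.ofReal_re]
  have h2 : A.trace.re = ∑ i, hA.1.eigenvalues i := by
    rw [hA.1.trace_eq_sum_eigenvalues, Complex.re_sum]
    rfl
  rw [h1, h2, Finset.sum_mul]
  refine Finset.sum_le_sum fun i _ => ?_
  rcases (hA.eigenvalues_nonneg i).eq_or_lt with h | h
  · rw [← h, zero_mul, zero_mul]
  · exact mul_le_mul_of_nonneg_left (Real.log_le_log h (Finset.single_le_sum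
      (f := hA.1.eigenvalues) (fun j _ => hA.eigenvalues_nonneg j) (Finset.mem_univ i))) h.le

/-- Divergence from the maximally mixed matrix of trace `τ`. -/
theorem vnDiv_smul_one_le {A : Matrix n n ℂ} (hA : A.PosSemidef) {τ : ℝ} (hτ : 0 < τ)
    (hn : 1 ≤ Real.log (Fintype.card n)) (htr : A.trace.re ≤ τ) :
    vnDiv A (((τ / Fintype.card n : ℝ) : ℂ) • 1) ≤ τ * Real.log (Fintype.card n) := by
  have hcard : (0 : ℝ) < Fintype.card n := by
    rcases (Nat.cast_nonneg (α := ℝ) (Fintype.card n)).eq_or_lt with h | h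
    · rw [← h, Real.log_zero] at hn
      linarith
    · exact h
  have hlog : matLog (((τ / Fintype.card n : ℝ) : ℂ) • (1 : Matrix n n ℂ)) =
      ((Real.log (τ / Fintype.card n) : ℝ) : ℂ) • 1 := by
    have h := cfc_algebraMap (A := Matrix n n ℂ) (τ / Fintype.card n : ℝ) Real.log
    simp only [Algebra.algebraMap_eq_smul_one] at h
    rw [matLog, Complex.coe_smul, Complex.coe_smul]
    exact h
  have h0 : 0 ≤ A.trace.re := (Complex.nonneg_iff.1 hA.trace_nonneg).1
  have h1 := trace_mul_matLog_le hA
  have h2 : A.trace.re * Real.log A.trace.re ≤ A.trace.re * Real.log τ := by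
    rcases h0.eq_or_lt with h | h
    · rw [← h, zero_mul, zero_mul]
    · exact mul_le_mul_of_nonneg_left (Real.log_le_log h htr) h.le
  have h3 : vnDiv A (((τ / Fintype.card n : ℝ) : ℂ) • 1) =
      (A * matLog A).trace.re - A.trace.re + τ -
        A.trace.re * (Real.log τ - Real.log (Fintype.card n)) := by
    rw [vnDiv, hlog, ← Real.log_div hτ.ne' hcard.ne']
    simp only [Complex.coe_smul, Matrix.mul_smul, Matrix.mul_one, Matrix.trace_sub,
      Matrix.trace_smul, Matrix.trace_one, Complex.sub_re,
      Complex.smul_re, Complex.natCast_re, smul_eq_mul]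
    field_simp
    ring
  -- With `a = Tr A`, the divergence is at most `τ - a + a log n`; since `log n ≥ 1`, this is at
  -- most `τ log n`.
  have h4 := mul_nonneg (sub_nonneg.2 htr) (sub_nonneg.2 hn)
  rw [h3]
  linarith

end Matrices

/-! ### Tensors -/

variable {N d : ℕ} [NeZero d]

theorem blkdiag_sub (X Y : CTensor N d) : blkdiag (X - Y) = blkdiag X - blkdiag Y := by
  rw [blkdiag, blkdiag, blkdiag, ← Matrix.blockDiagonal_sub, fft, fft, fft, map_sub]

theorem blkdiag_add_smul (V X : CTensor N d) (r : ℝ) :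
    blkdiag (V + r • X) = blkdiag V + r • blkdiag X := by
  have h : r • X = (r : ℂ) • X := by
    ext
    simp
  rw [h, blkdiag, blkdiag, blkdiag, fft, fft, fft, map_add, map_smul, Matrix.blockDiagonal_add,
    Matrix.blockDiagonal_smul, Complex.coe_smul]

theorem blockDiagonal_posSemidef {n o : Type*} [Fintype n] [Fintype o] [DecidableEq n]
    [DecidableEq o] {M : o → Matrix n n ℂ} (hM : ∀ k, (M k).PosSemidef) :
    (Matrix.blockDiagonal M).PosSemidef := by
  refine Matrix.PosSemidef.of_dotProduct_mulVec_nonneg ?_ fun x => ?_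
  · rw [Matrix.IsHermitian, Matrix.blockDiagonal_conjTranspose]
    exact congrArg _ (funext fun k => (hM k).1.eq)
  · have h : star x ⬝ᵥ (Matrix.blockDiagonal M *ᵥ x) =
        ∑ k, star (fun i => x (i, k)) ⬝ᵥ (M k *ᵥ fun i => x (i, k)) := by
      simp only [dotProduct, Matrix.mulVec, Fintype.sum_prod_type, Matrix.blockDiagonal_apply,
        ite_mul, zero_mul, Finset.sum_ite_eq, Finset.mem_univ, if_true, Pi.star_apply]
      exact Finset.sum_comm
    rw [h]
    exact Finset.sum_nonneg fun k _ => (hM k).dotProduct_mulVec_nonneg _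

theorem IsPosSemidef.blkdiag {X : CTensor N d} (hX : IsPosSemidef X) : (blkdiag X).PosSemidef :=
  blockDiagonal_posSemidef hX

theorem IsPosDef.blkdiag {X : CTensor N d} (hX : IsPosDef X) : (blkdiag X).PosDef := by
  refine (IsPosSemidef.blkdiag fun k => (hX k).posSemidef).posDef_iff_isUnit.2 ?_
  rw [Matrix.isUnit_iff_isUnit_det, TEG.blkdiag, Matrix.det_blockDiagonal, isUnit_iff_ne_zero,
    Finset.prod_ne_zero_iff]
  exact fun k _ => (hX k).det_pos.ne'

theorem IsSymm.blkdiag {X : CTensor N d} (hX : IsSymm X) : (blkdiag X).IsHermitian := by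
  rw [Matrix.IsHermitian, TEG.blkdiag, Matrix.blockDiagonal_conjTranspose]
  exact congrArg _ (funext fun k => by rw [← fft_tTranspose, hX])

theorem blkdiag_tLog {W : CTensor N d} (hW : IsPosDef W) :
    blkdiag (tLog W) = matLog (blkdiag W) := by
  rw [blkdiag, tLog, fft, ifft, LinearEquiv.apply_symm_apply, matLog, blkdiag,
    cfc_blockDiagonal fun k => (hW k).1, Matrix.blockDiag_blockDiagonal]

theorem matLog_isHermitian {n : Type*} [Fintype n] [DecidableEq n] (A : Matrix n n ℂ) :
    (matLog A).IsHermitian :=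
  cfc_predicate Real.log A

theorem divergence_eq (U : CTensor N d) {W : CTensor N d} (hW : IsPosDef W) :
    divergence U W = vnDiv (blkdiag U) (blkdiag W) := by
  rw [divergence, tInner_eq, blkdiag_tLog hW, (matLog_isHermitian _).eq, blkdiag_sub]
  rfl

theorem tInner_tTranspose {L : CTensor N d} (hL : IsSymm L) (U : CTensor N d) :
    tInner U (tTranspose L) = (blkdiag U * blkdiag L).trace.re := by
  have h : tTranspose L = L := hL
  rw [tInner_eq, h, hL.blkdiag.eq]

theorem trace_blkdiag_mul_sq (W L : CTensor N d) :
    (blkdiag W * blkdiag L ^ 2).trace.re = ∑ k, (fft W k * fft L k ^ 2).trace.re := by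
  rw [blkdiag, blkdiag, ← Matrix.blockDiagonal_pow, ← Matrix.blockDiagonal_mul,
    Matrix.trace_blockDiagonal, Complex.re_sum]
  rfl

/-- One-step regret against a comparator, in terms of the divergence to it. -/
theorem loss_sub_loss_le {U W L : CTensor N d} (hU : IsPosSemidef U) (hW : IsPosDef W)
    (hL : IsSymm L) {η : ℝ} (hnorm : specNorm ((η : ℂ) • blkdiag L) ≤ 1) :
    η * (loss L W - loss L U) ≤ vnDiv (blkdiag U) (blkdiag W) +
      η ^ 2 * (blkdiag W * blkdiag L ^ 2).trace.re := by
  have hη : (η • blkdiag L).IsHermitian := hL.blkdiag.smul (IsSelfAdjoint.all _)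
  rw [Complex.coe_smul] at hnorm
  have hsq := posSemidef_one_sub_sq_of_specNorm_le hη hnorm
  -- The contraction is `K = -ηL`, since `(U - W)K = η(W - U)L`.
  rw [← neg_sq] at hsq
  have h := vnDiv_ge_of_contraction hU.blkdiag hW.blkdiag hη.neg hsq
  rw [neg_sq, smul_pow] at h
  simp only [loss_eq, Matrix.sub_mul, Matrix.mul_neg, Matrix.mul_smul, Matrix.trace_sub,
    Matrix.trace_neg, Matrix.trace_smul, Complex.sub_re, Complex.neg_re, Complex.smul_re,
    smul_eq_mul] at h ⊢
  linarith

/-- One-step regret of the exponentiated gradient update. -/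
theorem loss_sub_loss_le_of_isMinOn {S : Set (CTensor N d)} (hS : Convex ℝ S)
    (hpos : ∀ X ∈ S, IsPosSemidef X) {U V W L : CTensor N d} (hU : U ∈ S) (hV : V ∈ S)
    (hVpos : IsPosDef V) (hW : IsPosDef W) (hL : IsSymm L) {η : ℝ}
    (hnorm : specNorm ((η : ℂ) • blkdiag L) ≤ 1)
    (hmin : IsMinOn (fun X => divergence X W + η * tInner X (tTranspose L)) S V) :
    η * (loss L W - loss L U) ≤ vnDiv (blkdiag U) (blkdiag W) - vnDiv (blkdiag U) (blkdiag V) +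
      η ^ 2 * (blkdiag W * blkdiag L ^ 2).trace.re := by
  -- `h1` bounds the loss gap from `W` to `V`, `h2` the gap from `V` to `U`; the divergence of `V`
  -- from `W` cancels in the sum.
  have h1 := loss_sub_loss_le (hpos V hV) hW hL hnorm
  have hmem : ∀ r : ℝ, 0 < r → r ≤ 1 → V + r • (U - V) ∈ S := fun r hr hr1 =>
    hS.add_smul_sub_mem hV hU ⟨hr.le, hr1⟩
  have hseg (r : ℝ) : blkdiag (V + r • (U - V)) =
      blkdiag V + r • (blkdiag U - blkdiag V) := by
    rw [blkdiag_add_smul, blkdiag_sub]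
  have h2 := vnDiv_pythagoras (U := blkdiag U) (V := blkdiag V) (W := blkdiag W)
    (G := η • blkdiag L) hVpos.blkdiag
    (fun r hr hr1 => hseg r ▸ (hpos _ (hmem r hr hr1)).blkdiag) fun r hr hr1 => by
      have h := isMinOn_iff.1 hmin _ (hmem r hr hr1)
      simp only [divergence_eq _ hW, tInner_tTranspose hL, hseg] at h
      simpa only [Matrix.mul_smul, Matrix.trace_smul, Complex.smul_re, smul_eq_mul] using h
  simp only [loss_eq, Matrix.sub_mul, Matrix.mul_smul, Matrix.trace_smul, Matrix.trace_sub,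
    Complex.smul_re, Complex.sub_re, smul_eq_mul] at h1 h2 ⊢
  linarith

/-! ### Initialization and summation over rounds -/

theorem one_le_log {N : ℕ} (hN : 3 ≤ N) : 1 ≤ Real.log N := by
  have h3 : (3 : ℝ) ≤ N := by exact_mod_cast hN
  rw [Real.le_log_iff_exp_le (by linarith)]
  linarith [Real.exp_one_lt_d9]

/-- Divergence of a comparator from the initial prediction. -/
theorem vnDiv_init_le (hN : 3 ≤ N) {τ : ZMod d → ℝ} {U W : CTensor N d} (hU : IsPosSemidef U)
    (htr : ∀ k, (fft U k).trace.re ≤ τ k) (hW : IsPosDef W)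
    (hinit : ∀ k, fft W k = ((τ k / N : ℝ) : ℂ) • (1 : Matrix (Fin N) (Fin N) ℂ)) :
    vnDiv (blkdiag U) (blkdiag W) ≤ ∑ k, τ k * Real.log N := by
  have hN0 : (0 : ℝ) < N := by exact_mod_cast (show 0 < N by omega)
  rw [blkdiag, blkdiag, vnDiv_blockDiagonal (fun k => (hU k).1) fun k => (hW k).1]
  refine Finset.sum_le_sum fun k _ => ?_
  -- Positive definiteness of the initial prediction forces `τ k` to be nonzero.
  have hτ : 0 < τ k := by
    have h := (hW k).diag_pos (i := ⟨0, by omega⟩)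
    rw [hinit, Matrix.smul_apply, Matrix.one_apply_eq, smul_eq_mul, mul_one,
      Complex.zero_lt_real] at h
    exact (div_pos_iff_of_pos_right hN0).1 h
  have h := vnDiv_smul_one_le (hU k) hτ (by simpa using one_le_log hN) (htr k)
  rwa [Fintype.card_fin, ← hinit k] at h

/-- Regret of Tensor Exponentiated Gradient against a fixed comparator. -/
theorem sum_loss_sub_le (hN : 3 ≤ N) {β τ : ZMod d → ℝ} {S : Set (CTensor N d)}
    (hS : IsDecisionSet β τ S) {T : ℕ} (hT : 0 < T) {L W : ℕ → CTensor N d}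
    (hL : ∀ t < T, IsSymm (L t)) {η : ℝ} (hη : 0 < η)
    (hnorm : ∀ t < T, specNorm ((η : ℂ) • blkdiag (L t)) ≤ 1) (hW : IsTEGRun τ S η T L W)
    {U : CTensor N d} (hU : U ∈ S) :
    ∑ t ∈ Finset.range T, loss (L t) (W t) - ∑ t ∈ Finset.range T, loss (L t) U ≤
      ∑ k, (η * ∑ t ∈ Finset.range T, (fft (W t) k * fft (L t) k ^ 2).trace.re
        + τ k * Real.log N / η) := by
  have htele : ∀ m < T, η * ∑ t ∈ Finset.range m, (loss (L t) (W t) - loss (L t) U) ≤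
      vnDiv (blkdiag U) (blkdiag (W 0)) - vnDiv (blkdiag U) (blkdiag (W m)) +
        η ^ 2 * ∑ t ∈ Finset.range m, (blkdiag (W t) * blkdiag (L t) ^ 2).trace.re := by
    intro m
    induction m with
    | zero => simp
    | succ m ih =>
      intro hm
      have hm' : m < T := Nat.lt_of_succ_lt hm
      have h := loss_sub_loss_le_of_isMinOn hS.convex hS.posSemidef hU (hW.mem _ hm)
        (hW.posDef _ hm) (hW.posDef _ hm') (hL m hm') (hnorm m hm') (hW.update m hm)
      rw [Finset.sum_range_succ, Finset.sum_range_succ, mul_add, mul_add]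
      linarith [ih hm']
  obtain ⟨m, rfl⟩ : ∃ m, T = m + 1 := ⟨T - 1, by omega⟩
  have h1 := htele m m.lt_succ_self
  -- The last round has no successor prediction, so the local bound is applied directly to `U`; its
  -- divergence term cancels the one left by the telescoping.
  have h2 := loss_sub_loss_le (hS.posSemidef U hU) (hW.posDef m m.lt_succ_self)
    (hL m m.lt_succ_self) (hnorm m m.lt_succ_self)
  have h3 := vnDiv_init_le hN (hS.posSemidef U hU) (hS.trace_le U hU) (hW.posDef 0 hT) hW.init
  have h4 : ∑ k, (η * ∑ t ∈ Finset.range (m + 1), (fft (W t) k * fft (L t) k ^ 2).trace.re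
        + τ k * Real.log N / η) =
      η * ∑ t ∈ Finset.range (m + 1), (blkdiag (W t) * blkdiag (L t) ^ 2).trace.re +
        (∑ k, τ k * Real.log N) / η := by
    simp only [trace_blkdiag_mul_sq]
    rw [Finset.sum_add_distrib, ← Finset.mul_sum, Finset.sum_comm, Finset.sum_div]
  rw [h4, ← Finset.sum_sub_distrib, ← mul_le_mul_iff_right₀ hη, mul_add, mul_div_cancel₀ _ hη.ne']
  rw [Finset.sum_range_succ, Finset.sum_range_succ]
  linarith

end TEG

end

/-! ### The regret bound -/

theorem mainTheorem2 {N d : ℕ} [NeZero d] (hN : 3 ≤ N)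
    (β τ : ZMod d → ℝ) (hτ : ∀ k, 0 ≤ τ k)
    (S : Set (TEG.CTensor N d)) (hS : TEG.IsDecisionSet β τ S)
    (T : ℕ) (L W : ℕ → TEG.CTensor N d) (hL : ∀ t < T, TEG.IsSymm (L t))
    (η : ℝ) (hη : 0 < η)
    (hnorm : ∀ t < T, TEG.specNorm ((η : ℂ) • TEG.blkdiag (L t)) ≤ 1)
    (hW : TEG.IsTEGRun τ S η T L W) :
    BddBelow ((fun U => ∑ t ∈ Finset.range T, TEG.loss (L t) U) '' S) ∧
    TEG.regret S T L W ≤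
      ∑ k, (η * ∑ t ∈ Finset.range T,
          (TEG.fft (W t) k * TEG.fft (L t) k ^ 2).trace.re
        + τ k * Real.log N / η) := by
  rcases T.eq_zero_or_pos with rfl | hT
  · have hlog := zero_le_one.trans (TEG.one_le_log hN)
    simp only [TEG.regret, TEG.bestLoss, Finset.range_zero, Finset.sum_empty, mul_zero, zero_add,
      zero_sub]
    refine ⟨⟨0, ?_⟩, ?_⟩
    · rintro _ ⟨U, _, rfl⟩
      exact le_rfl
    -- Without rounds `S` may be empty; the infimum of the empty set is then `0` by convention.
    · have h : 0 ≤ sInf ((fun _ : TEG.CTensor N d => (0 : ℝ)) '' S) :=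
        Real.sInf_nonneg (by rintro _ ⟨U, _, rfl⟩; exact le_rfl)
      exact (neg_nonpos.2 h).trans
        (Finset.sum_nonneg fun k _ => div_nonneg (mul_nonneg (hτ k) hlog) hη.le)
  · have h := fun U (hU : U ∈ S) => TEG.sum_loss_sub_le hN hS hT hL hη hnorm hW hU
    -- The bound is independent of the comparator, so rearranged it is a lower bound for the
    -- cumulative loss on `S`; this gives both boundedness and regret.
    have hb : ∀ x ∈ (fun U => ∑ t ∈ Finset.range T, TEG.loss (L t) U) '' S,
        ∑ t ∈ Finset.range T, TEG.loss (L t) (W t) -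
          ∑ k, (η * ∑ t ∈ Finset.range T,
              (TEG.fft (W t) k * TEG.fft (L t) k ^ 2).trace.re
            + τ k * Real.log N / η) ≤ x := by
      rintro _ ⟨U, hU, rfl⟩
      exact sub_le_comm.1 (h U hU)
    exact ⟨⟨_, hb⟩, sub_le_comm.1 (le_csInf ⟨_, W 0, hW.mem 0 hT, rfl⟩ hb)⟩
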